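/- For an $n\times n$ complex Hermitian matrix $X$ let $\lambda_1(X)\ge\lambda_2(X)\ge\dots\ge\lambda_n(X)$ be its eigenvalues, counted with multiplicity, and let $X\le Y$ mean that $Y-X$ is positive semidefinite. For positive definite $A,B$ and $\alpha\in[0,1]$ put $$A\sharp_\alpha B=A^{1/2}\bigl(A^{-1/2}BA^{-1/2}\bigr)^{\alpha}A^{1/2},\qquad A\sharp B=A\sharp_{1/2}B.$$ For $w>0$ and $\alpha\in\mathbb R$ the generalized Kantorovich constant $K(w,\alpha)$ is defined by $$K(w,\alpha)=\frac{w^\alpha-w}{(\alpha-1)(w-1)}\left(\frac{\alpha-1}{\alpha}\,\frac{w^\alpha-1}{w^\alpha-w}\right)^{\alpha}\quad(w\ne1,\ \alpha\ne0,1),$$ and $K(w,\alpha)=1$ (the limit value) if $w=1$, $\alpha=0$ or $\alpha=1$. Let $H,K$ be $n\times n$ Hermitian matrices with $mI\le H\le MI$ and $mI\le K\le MI$ for some real scalars $m\le M$, and let $\alpha\in[0,1]$. Then for every $p>0$ and every $k=1,\dots,n$, $$\lambda_k\bigl(e^{(1-\alpha)H+\alpha K}\bigr)\le K\bigl(e^{2p(M-m)},\alpha\bigr)^{-1/p}\,\lambda_k\bigl(e^{pH}\sharp_\alpha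 e^{pK}\bigr)^{1/p},$$ and for every $k$ the right-hand side converges to the left-hand side as $p\downarrow0$. In particular, for every $k=1,\dots,n$, $$\lambda_k\bigl(e^{H+K}\bigr)\le\frac{e^{2M}+e^{2m}}{2e^{M}e^{m}}\,\lambda_k\bigl(e^{2H}\sharp e^{2K}\bigr).$$ -/

import Mathlib

open scoped MatrixOrder

/-- The `k`-th eigenvalue `λ_k(A)` of an `n × n` Hermitian matrix `A`, where the eigenvalues are
listed in decreasing order and repeated according to multiplicity. The index `k : Fin n` starts at
`0`, so that `lam A hA 0` is the largest eigenvalue. -/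
noncomputable def lam {n : ℕ} (A : Matrix (Fin n) (Fin n) ℂ) (hA : A.IsHermitian) (k : Fin n) : ℝ :=
  hA.eigenvalues₀ (Fin.cast (Fintype.card_fin n).symm k)

/-- The weighted geometric mean `A ♯_α B = A^{1/2} (A^{-1/2} B A^{-1/2})^α A^{1/2}` of positive
definite matrices `A` and `B`; real powers are those of the continuous functional calculus. -/
noncomputable def geomMean {n : ℕ} (α : ℝ) (A B : Matrix (Fin n) (Fin n) ℂ) :
    Matrix (Fin n) (Fin n) ℂ :=
  A ^ (1 / 2 : ℝ) * (A ^ (-(1 / 2) : ℝ) * B * A ^ (-(1 / 2) : ℝ)) ^ α * A ^ (1 / 2 : ℝ)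

/-- The generalized Kantorovich constant `K(w, α)`. In the cases `w = 1`, `α = 0` and `α = 1` the
defining formula has a vanishing denominator, and `K` takes there its limit value `1`. -/
noncomputable def kantorovich (w α : ℝ) : ℝ :=
  if w = 1 ∨ α = 0 ∨ α = 1 then 1
  else (w ^ α - w) / ((α - 1) * (w - 1)) *
    ((α - 1) / α * ((w ^ α - 1) / (w ^ α - w))) ^ α

theorem isHermitian_geomMean {n : ℕ} (α : ℝ) (A B : Matrix (Fin n) (Fin n) ℂ) :
    (geomMean α A B).IsHermitian := by
  have key : ∀ (C : Matrix (Fin n) (Fin n) ℂ) (x : ℝ), (C ^ x).IsHermitian := fun C x =>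
    (IsSelfAdjoint.of_nonneg (CFC.rpow_nonneg (a := C) (y := x))).isHermitian
  have h := Matrix.isHermitian_mul_mul_conjTranspose (A ^ (1 / 2 : ℝ))
    (key (A ^ (-(1 / 2) : ℝ) * B * A ^ (-(1 / 2) : ℝ)) α)
  rwa [(key A (1 / 2)).eq] at h

theorem isHermitian_exp_comb {n : ℕ} {H K : Matrix (Fin n) (Fin n) ℂ} (hH : H.IsHermitian)
    (hK : K.IsHermitian) (a b : ℝ) : (NormedSpace.exp (a • H + b • K)).IsHermitian :=
  ((hH.smul (IsSelfAdjoint.all a)).add (hK.smul (IsSelfAdjoint.all b))).exp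

theorem isHermitian_exp_add {n : ℕ} {H K : Matrix (Fin n) (Fin n) ℂ} (hH : H.IsHermitian)
    (hK : K.IsHermitian) : (NormedSpace.exp (H + K)).IsHermitian :=
  (hH.add hK).exp

/-! Put A = e^{pH}, B = e^{pK}, L = (1-α)H + αK and u = p(M-m). Then e^{-u}A ≤ B ≤ e^u A, so
A^{-1/2}BA^{-1/2} has spectrum in [e^{-u}, e^u]. There x^α lies above its chord (1-α)a + αbx, and
the Kantorovich constant κ = K(e^{2u}, α) is exactly a^{1-α}b^α. Conjugation by A^{1/2} gives
(1-α)aA + αbB ≤ A ♯_α B. Since log is operator monotone and operator concave, log κ + pL ≤ log(A ♯_α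
B). Each λ_k is monotone and commutes with increasing functions, so dividing by p and exponentiating
yields the inequality.

For the limit, x^α ≤ 1-α+αx and e^y ≤ 1+y+y² for |y| ≤ 1 give A ♯_α B ≤ 1 + (pR)² + pL, where R
bounds |m| and |M|. With κ ≥ e^{-u²/2}, the right-hand side is at most e^{O(p)} λ_k(e^L), and a
squeeze concludes. -/

/-! ### Eigenvalues: monotonicity and functional calculus -/

open Module in
/-- Courant–Fischer style comparison of two quadratic forms diagonal in orthonormal bases. -/
theorem le_of_weighted_sum_inner_le {E : Type*} [NormedAddCommGroup E] [InnerProductSpace ℂ E]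
    {N : ℕ} (u v : OrthonormalBasis (Fin N) ℂ E) {a b : Fin N → ℝ} (ha : Antitone a)
    (hb : Antitone b)
    (h : ∀ x : E, ∑ i, a i * ‖inner ℂ (u i) x‖ ^ 2 ≤ ∑ i, b i * ‖inner ℂ (v i) x‖ ^ 2)
    (k : Fin N) : a k ≤ b k := by
  have : FiniteDimensional ℂ E := u.toBasis.finiteDimensional_of_finite
  -- These are N-1 linear conditions on an N-dimensional space. A nonzero solution x has no
  -- v-components below k and no u-components above k, which leaves only indices with a i ≥ a k and
  -- with b i ≤ b k.
  let φ : E →ₗ[ℂ] ({i : Fin N // i ≠ k} → ℂ) :=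
    LinearMap.pi fun i => if i.1 < k then (innerₛₗ ℂ (v i.1)) else (innerₛₗ ℂ (u i.1))
  have hrank : finrank ℂ ({i : Fin N // i ≠ k} → ℂ) < finrank ℂ E := by
    rw [finrank_fintype_fun_eq_card, finrank_eq_card_basis u.toBasis]
    exact Fintype.card_subtype_lt (x := k) (by simp)
  obtain ⟨x, hx, hx0⟩ := Submodule.exists_mem_ne_zero_of_ne_bot
    (LinearMap.ker_ne_bot_of_finrank_lt (f := φ) hrank)
  have hker : ∀ i, i ≠ k → (if i < k then inner ℂ (v i) x else inner ℂ (u i) x) = 0 := by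
    intro i hi
    have := congrFun (LinearMap.mem_ker.1 hx) ⟨i, hi⟩
    simp only [φ, LinearMap.pi_apply] at this
    split_ifs at this ⊢ <;> simpa using this
  have hpos : 0 < ‖x‖ ^ 2 := by positivity
  refine le_of_mul_le_mul_right ?_ hpos
  calc a k * ‖x‖ ^ 2 = ∑ i, a k * ‖inner ℂ (u i) x‖ ^ 2 := by
        rw [← Finset.mul_sum, u.sum_sq_norm_inner_right]
    _ ≤ ∑ i, a i * ‖inner ℂ (u i) x‖ ^ 2 := by
        refine Finset.sum_le_sum fun i _ => ?_
        rcases le_or_gt i k with hik | hik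
        · exact mul_le_mul_of_nonneg_right (ha hik) (by positivity)
        · have := hker i hik.ne'
          rw [if_neg hik.not_gt] at this
          simp [this]
    _ ≤ ∑ i, b i * ‖inner ℂ (v i) x‖ ^ 2 := h x
    _ ≤ ∑ i, b k * ‖inner ℂ (v i) x‖ ^ 2 := by
        refine Finset.sum_le_sum fun i _ => ?_
        rcases lt_or_ge i k with hik | hik
        · have := hker i hik.ne
          rw [if_pos hik] at this
          simp [this]
        · exact mul_le_mul_of_nonneg_right (hb hik) (by positivity)
    _ = b k * ‖x‖ ^ 2 := by
        rw [← Finset.mul_sum, v.sum_sq_norm_inner_right]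

namespace Matrix.IsHermitian

variable {ι : Type*} [Fintype ι] [DecidableEq ι]

theorem re_inner_toEuclideanLin {A : Matrix ι ι ℂ} (hA : A.IsHermitian)
    (x : EuclideanSpace ℂ ι) :
    (inner ℂ x (toEuclideanLin A x)).re =
      ∑ i, hA.eigenvalues i * ‖inner ℂ (hA.eigenvectorBasis i) x‖ ^ 2 := by
  rw [← hA.eigenvectorBasis.sum_inner_mul_inner, Complex.re_sum]
  refine Finset.sum_congr rfl fun i _ => ?_
  have hsymm := isSymmetric_toEuclideanLin_iff.2 hA
  have heig : toEuclideanLin A (hA.eigenvectorBasis i) =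
      (hA.eigenvalues i : ℂ) • hA.eigenvectorBasis i := by
    ext j
    have := congrFun (hA.mulVec_eigenvectorBasis i) j
    simpa [toLpLin_apply] using this
  rw [← hsymm, heig, inner_smul_left, Complex.conj_ofReal, mul_left_comm, Complex.re_ofReal_mul,
    ← inner_conj_symm x, Complex.conj_mul', ← Complex.ofReal_pow, Complex.ofReal_re]

theorem eigenvalues₀_mono {A B : Matrix ι ι ℂ} (hA : A.IsHermitian) (hB : B.IsHermitian)
    (h : A ≤ B) (k : Fin (Fintype.card ι)) : hA.eigenvalues₀ k ≤ hB.eigenvalues₀ k := by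
  -- `eigenvalues` is `eigenvalues₀` transported along this equivalence, so reindexing pairs each
  -- eigenvector with its place in the decreasing order.
  let e : ι ≃ Fin (Fintype.card ι) := (Fintype.equivOfCardEq (Fintype.card_fin _)).symm
  refine le_of_weighted_sum_inner_le (hA.eigenvectorBasis.reindex e)
    (hB.eigenvectorBasis.reindex e) hA.eigenvalues₀_antitone hB.eigenvalues₀_antitone ?_ k
  intro x
  have key : ∀ {C : Matrix ι ι ℂ} (hC : C.IsHermitian),
      ∑ i, hC.eigenvalues₀ i * ‖inner ℂ (hC.eigenvectorBasis.reindex e i) x‖ ^ 2 =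
        (inner ℂ x (toEuclideanLin C x)).re := by
    intro C hC
    rw [hC.re_inner_toEuclideanLin, ← e.sum_comp]
    simp [eigenvalues, e]
  rw [key hA, key hB, ← sub_nonneg, ← Complex.sub_re, ← inner_sub_right, ← LinearMap.sub_apply,
    ← map_sub]
  have := (le_iff.1 h).re_dotProduct_nonneg x.ofLp
  rw [EuclideanSpace.inner_eq_star_dotProduct, dotProduct_comm]
  simpa [toLpLin_apply, sub_mulVec, dotProduct_sub] using this

theorem eigenvalues₀_mem_spectrum {A : Matrix ι ι ℂ} (hA : A.IsHermitian)
    (k : Fin (Fintype.card ι)) : hA.eigenvalues₀ k ∈ spectrum ℝ A := by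
  rw [hA.spectrum_real_eq_range_eigenvalues]
  exact ⟨Fintype.equivOfCardEq (Fintype.card_fin _) k, by simp [eigenvalues]⟩

/-- Both sides list the same multiset of characteristic roots. Monotonicity of f on the spectrum
keeps the right-hand list sorted, so sorting does not change it. -/
theorem eigenvalues₀_cfc {A : Matrix ι ι ℂ} (hA : A.IsHermitian) {f : ℝ → ℝ}
    (hf : MonotoneOn f (spectrum ℝ A)) (hB : (cfc f A).IsHermitian) :
    hB.eigenvalues₀ = f ∘ hA.eigenvalues₀ := by
  have hroots : (cfc f A).charpoly.roots.map RCLike.re =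
      Multiset.map (f ∘ hA.eigenvalues₀) Finset.univ.val := by
    calc (cfc f A).charpoly.roots.map RCLike.re
        = Multiset.map (f ∘ hA.eigenvalues) Finset.univ.val := by
          rw [hA.charpoly_cfc_eq, Polynomial.roots_prod _ _
            (Finset.prod_ne_zero_iff.2 fun i _ => Polynomial.X_sub_C_ne_zero _)]
          simp
      _ = (A.charpoly.roots.map RCLike.re).map f := by
          rw [hA.roots_charpoly_eq_eigenvalues]
          simp
      _ = _ := by
          rw [hA.roots_charpoly_eq_eigenvalues₀]
          simp [Function.comp_def]
  have hanti : Antitone (f ∘ hA.eigenvalues₀) := fun i j hij =>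
    hf (hA.eigenvalues₀_mem_spectrum j) (hA.eigenvalues₀_mem_spectrum i) (hA.eigenvalues₀_antitone hij)
  rw [← List.ofFn_inj, ← sort_roots_charpoly_eq_eigenvalues₀, hroots, Fin.univ_val_map,
    Multiset.coe_sort]
  refine List.mergeSort_of_pairwise ?_
  simp_rw [decide_eq_true_eq, ← List.sortedGE_iff_pairwise]
  exact hanti.sortedGE_ofFn

end Matrix.IsHermitian

theorem lam_mono {n : ℕ} {A B : Matrix (Fin n) (Fin n) ℂ} (hA : A.IsHermitian)
    (hB : B.IsHermitian) (h : A ≤ B) (k : Fin n) : lam A hA k ≤ lam B hB k :=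
  hA.eigenvalues₀_mono hB h _

theorem lam_cfc {n : ℕ} {A : Matrix (Fin n) (Fin n) ℂ} (hA : A.IsHermitian) {f : ℝ → ℝ}
    (hf : MonotoneOn f (spectrum ℝ A)) (hB : (cfc f A).IsHermitian) (k : Fin n) :
    lam (cfc f A) hB k = f (lam A hA k) :=
  congrFun (hA.eigenvalues₀_cfc hf hB) _

theorem lam_mem_spectrum {n : ℕ} {A : Matrix (Fin n) (Fin n) ℂ} (hA : A.IsHermitian) (k : Fin n) :
    lam A hA k ∈ spectrum ℝ A :=
  hA.eigenvalues₀_mem_spectrum _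

/-! ### Scalar inequalities and the Kantorovich constant -/

namespace Real

theorem sinh_le_mul_cosh {x : ℝ} (hx : 0 ≤ x) : sinh x ≤ x * cosh x := by
  have hmono : MonotoneOn (fun y : ℝ => y * cosh y - sinh y) (Set.Ici 0) := by
    refine monotoneOn_of_deriv_nonneg (convex_Ici 0) (by fun_prop) (by fun_prop) ?_
    intro y hy
    rw [interior_Ici] at hy
    have hd : HasDerivAt (fun y : ℝ => y * cosh y - sinh y) (1 * cosh y + y * sinh y - cosh y) y :=
      ((hasDerivAt_id y).mul (hasDerivAt_cosh y)).sub (hasDerivAt_sinh y)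
    rw [hd.deriv]
    have : 0 ≤ y * sinh y := mul_nonneg (le_of_lt hy) (sinh_nonneg_iff.2 (le_of_lt hy))
    linarith
  have := hmono (Set.mem_Ici.2 le_rfl) hx hx
  simp only [zero_mul, sinh_zero, sub_zero] at this
  linarith

/-- Combines sinh x ≤ x cosh x ≤ x e^{x²/2} with cx ≤ sinh(cx). The bound is independent of c and
quadratic in x, so it survives the power -1/p as p ↓ 0. -/
theorem exp_neg_half_sq_le_div_sinh {c x : ℝ} (hc : 0 < c) (hx : 0 < x) :
    exp (-(x ^ 2 / 2)) ≤ sinh (c * x) / (c * sinh x) := by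
  have hs : 0 < sinh x := sinh_pos_iff.2 hx
  rw [le_div_iff₀ (by positivity), exp_neg, inv_mul_le_iff₀ (exp_pos _)]
  calc c * sinh x ≤ c * (x * cosh x) := by gcongr; exact sinh_le_mul_cosh hx.le
    _ = cosh x * (c * x) := by ring
    _ ≤ exp (x ^ 2 / 2) * sinh (c * x) := by
        gcongr
        · exact cosh_le_exp_half_sq x
        · exact self_le_sinh_iff.2 (by positivity)

/-- The power function lies above its chord over `[e^{-u}, e^u]`. -/
theorem chord_le_rpow {α u x : ℝ} (hα0 : 0 ≤ α) (hα1 : α ≤ 1) (hu : 0 < u)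
    (hx : x ∈ Set.Icc (exp (-u)) (exp u)) :
    sinh ((1 - α) * u) / sinh u + sinh (α * u) / sinh u * x ≤ x ^ α := by
  have hs : 0 < sinh u := sinh_pos_iff.2 hu
  have hlt : exp (-u) < exp u := exp_lt_exp.2 (by linarith)
  -- At e = ±1 the argument is e^{±u} and the value is e^{±αu}: the affine function interpolates the
  -- power at both endpoints.
  have hend : ∀ e : ℝ, sinh ((1 - α) * u) / sinh u + sinh (α * u) / sinh u * (cosh u + e * sinh u)
      = cosh (α * u) + e * sinh (α * u) := by
    intro e
    rw [show (1 - α) * u = u - α * u by ring, sinh_sub]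
    field_simp
    ring
  have h1 := hend (-1)
  have h2 := hend 1
  simp only [one_mul, cosh_add_sinh, neg_mul, ← sub_eq_add_neg, cosh_sub_sinh] at h1 h2
  obtain ⟨s, t, hs0, ht0, hst, rfl⟩ := (Convex.mem_Icc hlt.le).1 hx
  have hconc := (concaveOn_rpow hα0 hα1).2 (exp_pos (-u)).le (exp_pos u).le hs0 ht0 hst
  simp only [smul_eq_mul, ← exp_mul] at hconc
  refine le_trans (le_of_eq ?_) hconc
  rw [show -u * α = -(α * u) by ring, show u * α = α * u by ring, ← h1, ← h2]
  linear_combination -(sinh ((1 - α) * u) / sinh u) * hst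

end Real

open Real in
-- The two bases are the normalized chord coefficients a and b, which is why the constant appears as
-- the defect.
theorem kantorovich_exp_two_mul {α u : ℝ} (hα0 : 0 < α) (hα1 : α < 1) (hu : 0 < u) :
    kantorovich (exp (2 * u)) α =
      (sinh ((1 - α) * u) / ((1 - α) * sinh u)) ^ (1 - α) * (sinh (α * u) / (α * sinh u)) ^ α := by
  have hs : 0 < sinh u := sinh_pos_iff.2 hu
  have hsα : 0 < sinh (α * u) := sinh_pos_iff.2 (by positivity)
  have hβ : 0 < 1 - α := by linarith
  have hsβ : 0 < sinh ((1 - α) * u) := sinh_pos_iff.2 (by positivity)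
  have hw : exp (2 * u) ≠ 1 := by simpa using hu.ne'
  have e1 : exp (2 * u) - 1 = 2 * exp u * sinh u := by
    rw [sinh_eq, exp_neg, two_mul, exp_add]; field_simp
  have e2 : exp (2 * u) ^ α - 1 = 2 * exp (α * u) * sinh (α * u) := by
    rw [← exp_mul, sinh_eq, exp_neg, show 2 * u * α = α * u + α * u by ring, exp_add]; field_simp
  have e3 : exp (2 * u) ^ α - exp (2 * u) =
      -(2 * exp (α * u) * exp u * sinh ((1 - α) * u)) := by
    rw [← exp_mul, sinh_eq, show -((1 - α) * u) = α * u - u by ring,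
      show (1 - α) * u = u - α * u by ring, show 2 * u * α = α * u + α * u by ring,
      two_mul, exp_add, exp_add, exp_sub, exp_sub]; field_simp; ring
  rw [kantorovich, if_neg (by simp [hw, hα0.ne', hα1.ne]), e1, e2, e3]
  set a := sinh ((1 - α) * u) / ((1 - α) * sinh u) with ha
  set b := sinh (α * u) / (α * sinh u) with hb
  have ha0 : 0 < a := by positivity
  have hb0 : 0 < b := by positivity
  have h1 : -(2 * exp (α * u) * exp u * sinh ((1 - α) * u)) / ((α - 1) * (2 * exp u * sinh u)) =
      exp (α * u) * a := by
    rw [ha, show α - 1 = -(1 - α) by ring]; field_simp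
  have h2 : (α - 1) / α * (2 * exp (α * u) * sinh (α * u) /
      -(2 * exp (α * u) * exp u * sinh ((1 - α) * u))) = b / (exp u * a) := by
    rw [ha, hb, show α - 1 = -(1 - α) by ring]; field_simp
  rw [h1, h2, div_rpow hb0.le (by positivity), mul_rpow (exp_pos _).le ha0.le, ← exp_mul,
    rpow_sub ha0, rpow_one, mul_comm u α]
  field_simp

open Real in
/-- Sharp linear lower bound for the power function on `[e^{-u}, e^u]`, in a form that covers the
degenerate cases `α = 0`, `α = 1` and `u = 0`. -/
theorem exists_linear_le_rpow_kantorovich {α u : ℝ} (hα : α ∈ Set.Icc (0 : ℝ) 1) (hu : 0 ≤ u) :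
    ∃ a b : ℝ, exp (-(u ^ 2 / 2)) ≤ a ∧ exp (-(u ^ 2 / 2)) ≤ b ∧
      kantorovich (exp (2 * u)) α = a ^ (1 - α) * b ^ α ∧
      ∀ x ∈ Set.Icc (exp (-u)) (exp u), (1 - α) * a + α * b * x ≤ x ^ α := by
  obtain ⟨hα0, hα1⟩ := hα
  have hexp : exp (-(u ^ 2 / 2)) ≤ 1 := exp_le_one_iff.2 (by nlinarith [sq_nonneg u])
  by_cases h : exp (2 * u) = 1 ∨ α = 0 ∨ α = 1
  · refine ⟨1, 1, hexp, hexp, by rw [kantorovich, if_pos h]; simp, ?_⟩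
    intro x hx
    rcases h with h | rfl | rfl
    · obtain rfl : u = 0 := by simpa using h
      obtain rfl : x = 1 := by simpa using hx
      simp
    · simp
    · simp
  · push Not at h
    have hα0 := lt_of_le_of_ne hα0 h.2.1.symm
    have hα1 := lt_of_le_of_ne hα1 h.2.2
    have hu : 0 < u := lt_of_le_of_ne hu (by rintro rfl; simp at h)
    have hβ : 0 < 1 - α := by linarith
    refine ⟨_, _, exp_neg_half_sq_le_div_sinh hβ hu, exp_neg_half_sq_le_div_sinh hα0 hu,
      kantorovich_exp_two_mul hα0 hα1 hu, fun x hx => ?_⟩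
    refine le_trans (le_of_eq ?_) (chord_le_rpow hα0.le hα1.le hu hx)
    have hs : 0 < sinh u := sinh_pos_iff.2 hu
    field_simp

/-! ### Operator inequalities for the geometric mean -/

section

open scoped Matrix.Norms.L2Operator

variable {n : ℕ} {A B H K : Matrix (Fin n) (Fin n) ℂ} {α : ℝ}

theorem spectrum_conj_rpow_subset_Icc (hA : IsStrictlyPositive A) (hB : IsSelfAdjoint B)
    {c d : ℝ} (hc : c • A ≤ B) (hd : B ≤ d • A) :
    spectrum ℝ (A ^ (-(1 / 2) : ℝ) * B * A ^ (-(1 / 2) : ℝ)) ⊆ Set.Icc c d := by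
  have hX : IsSelfAdjoint (A ^ (-(1 / 2) : ℝ)) := .of_nonneg CFC.rpow_nonneg
  have hS : IsSelfAdjoint (A ^ (-(1 / 2) : ℝ) * B * A ^ (-(1 / 2) : ℝ)) := by
    have := hB.conjugate (A ^ (-(1 / 2) : ℝ))
    rwa [hX.star_eq] at this
  have hone : A ^ (-(1 / 2) : ℝ) * A * A ^ (-(1 / 2) : ℝ) = 1 := by
    conv_lhs => enter [1, 2]; rw [← CFC.rpow_one A hA.nonneg]
    rw [← CFC.rpow_add hA.isUnit, ← CFC.rpow_add hA.isUnit]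
    norm_num
    exact CFC.rpow_zero A hA.nonneg
  have hsc : ∀ e : ℝ, A ^ (-(1 / 2) : ℝ) * (e • A) * A ^ (-(1 / 2) : ℝ) =
      algebraMap ℝ (Matrix (Fin n) (Fin n) ℂ) e := by
    intro e
    rw [mul_smul_comm, smul_mul_assoc, hone, Algebra.algebraMap_eq_smul_one]
  have h1 := hX.conjugate_le_conjugate hc
  have h2 := hX.conjugate_le_conjugate hd
  rw [hsc] at h1 h2
  intro x hx
  exact ⟨(algebraMap_le_iff_le_spectrum hS).1 h1 x hx, (le_algebraMap_iff_spectrum_le hS).1 h2 x hx⟩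

theorem geomMean_eq_cfc (hB : 0 ≤ B) : geomMean α A B = A ^ (1 / 2 : ℝ) *
    cfc (fun x : ℝ => x ^ α) (A ^ (-(1 / 2) : ℝ) * B * A ^ (-(1 / 2) : ℝ)) * A ^ (1 / 2 : ℝ) := by
  rw [geomMean, CFC.rpow_eq_cfc_real (a := A ^ (-(1 / 2) : ℝ) * B * A ^ (-(1 / 2) : ℝ))
    (ha := conjugate_nonneg_of_nonneg hB CFC.rpow_nonneg)]

/-- Undoes the conjugation for affine functions, so scalar affine bounds on x^α become operator
bounds on the mean. -/
theorem conj_rpow_cfc_linear (hA : IsStrictlyPositive A) (hB : IsSelfAdjoint B) (s t : ℝ) :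
    A ^ (1 / 2 : ℝ) * cfc (fun x : ℝ => s + t * x)
      (A ^ (-(1 / 2) : ℝ) * B * A ^ (-(1 / 2) : ℝ)) * A ^ (1 / 2 : ℝ) = s • A + t • B := by
  have hS : IsSelfAdjoint (A ^ (-(1 / 2) : ℝ) * B * A ^ (-(1 / 2) : ℝ)) := by
    have := hB.conjugate (A ^ (-(1 / 2) : ℝ))
    rwa [(IsSelfAdjoint.of_nonneg (CFC.rpow_nonneg (a := A))).star_eq] at this
  have h1 : A ^ (1 / 2 : ℝ) * A ^ (-(1 / 2) : ℝ) = 1 := CFC.rpow_mul_rpow_neg _ hA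
  have h2 : A ^ (-(1 / 2) : ℝ) * A ^ (1 / 2 : ℝ) = 1 := CFC.rpow_neg_mul_rpow _ hA
  have h3 : A ^ (1 / 2 : ℝ) * A ^ (1 / 2 : ℝ) = A := by
    rw [← CFC.rpow_add hA.isUnit]
    norm_num
    exact CFC.rpow_one A hA.nonneg
  have h4 : A ^ (1 / 2 : ℝ) * (A ^ (-(1 / 2) : ℝ) * B * A ^ (-(1 / 2) : ℝ)) * A ^ (1 / 2 : ℝ) =
      B := by
    calc _ = (A ^ (1 / 2 : ℝ) * A ^ (-(1 / 2) : ℝ)) * B *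
          (A ^ (-(1 / 2) : ℝ) * A ^ (1 / 2 : ℝ)) := by simp only [mul_assoc]
      _ = B := by rw [h1, h2, one_mul, mul_one]
  rw [cfc_const_add _ _ _, cfc_const_mul_id _ _ hS, Algebra.algebraMap_eq_smul_one, mul_add,
    add_mul, mul_smul_comm, smul_mul_assoc, mul_one, h3, mul_smul_comm, smul_mul_assoc, h4]

theorem linear_le_geomMean (hA : IsStrictlyPositive A) (hB : 0 ≤ B)
    {c d s t : ℝ} (hc0 : 0 < c) (hc : c • A ≤ B) (hd : B ≤ d • A)
    (h : ∀ x ∈ Set.Icc c d, s + t * x ≤ x ^ α) : s • A + t • B ≤ geomMean α A B := by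
  have hB' := IsSelfAdjoint.of_nonneg hB
  have hsp := spectrum_conj_rpow_subset_Icc hA hB' hc hd
  rw [geomMean_eq_cfc hB, ← conj_rpow_cfc_linear hA hB']
  refine (IsSelfAdjoint.of_nonneg CFC.rpow_nonneg).conjugate_le_conjugate ?_
  refine cfc_mono (fun x hx => h x (hsp hx)) (by fun_prop) ?_
  exact continuousOn_id.rpow_const fun x hx => .inl (hc0.trans_le (hsp hx).1).ne'

theorem geomMean_le_linear (hA : IsStrictlyPositive A) (hB : 0 ≤ B)
    {c d s t : ℝ} (hc0 : 0 < c) (hc : c • A ≤ B) (hd : B ≤ d • A)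
    (h : ∀ x ∈ Set.Icc c d, x ^ α ≤ s + t * x) : geomMean α A B ≤ s • A + t • B := by
  have hB' := IsSelfAdjoint.of_nonneg hB
  have hsp := spectrum_conj_rpow_subset_Icc hA hB' hc hd
  rw [geomMean_eq_cfc hB, ← conj_rpow_cfc_linear hA hB']
  refine (IsSelfAdjoint.of_nonneg CFC.rpow_nonneg).conjugate_le_conjugate ?_
  refine cfc_mono (fun x hx => h x (hsp hx)) ?_ (by fun_prop)
  exact continuousOn_id.rpow_const fun x hx => .inl (hc0.trans_le (hsp hx).1).ne'

theorem rpow_le_one_sub_add_mul {x : ℝ} (hα : α ∈ Set.Icc (0 : ℝ) 1) (hx : 0 ≤ x) :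
    x ^ α ≤ (1 - α) + α * x := by
  have := Real.geom_mean_le_arith_mean2_weighted (sub_nonneg.2 hα.2) hα.1 zero_le_one hx
    (sub_add_cancel 1 α)
  simpa using this

/-- Operator concavity of the logarithm for scaled arguments. -/
theorem log_add_smul_le_log_add (hA : IsStrictlyPositive A) (hB : IsStrictlyPositive B)
    (hα : α ∈ Set.Icc (0 : ℝ) 1) {a b : ℝ} (ha : 0 < a) (hb : 0 < b) :
    (Real.log (a ^ (1 - α) * b ^ α)) • (1 : Matrix (Fin n) (Fin n) ℂ) +
      ((1 - α) • CFC.log A + α • CFC.log B) ≤ CFC.log (((1 - α) * a) • A + (α * b) • B) := by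
  have h := CFC.concaveOn_log.2 (hA.smul ha) (hB.smul hb) (sub_nonneg.2 hα.2) hα.1
    (sub_add_cancel 1 α)
  rw [CFC.log_smul' A ha hA, CFC.log_smul' B hb hB] at h
  rw [mul_smul, mul_smul]
  refine le_trans (le_of_eq ?_) h
  rw [Real.log_mul (Real.rpow_pos_of_pos ha _).ne' (Real.rpow_pos_of_pos hb _).ne',
    Real.log_rpow ha, Real.log_rpow hb, Algebra.algebraMap_eq_smul_one,
    Algebra.algebraMap_eq_smul_one]
  module

/-! ### Exponentials of bounded Hermitian matrices -/

theorem exp_smul_eq_cfc (hH : IsSelfAdjoint H) (p : ℝ) :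
    NormedSpace.exp (p • H) = cfc (fun x : ℝ => Real.exp (p * x)) H := by
  rw [← CFC.real_exp_eq_normedSpace_exp ((IsSelfAdjoint.all p).smul hH)]
  exact (cfc_comp_const_mul p Real.exp H (by fun_prop) hH).symm

theorem cfc_const_add_mul_eq (hH : IsSelfAdjoint H) (s t : ℝ) :
    cfc (fun x : ℝ => s + t * x) H = s • 1 + t • H := by
  rw [cfc_const_add _ _ _, cfc_const_mul_id _ _ hH, Algebra.algebraMap_eq_smul_one]

theorem spectrum_subset_Icc {m M : ℝ} (hH : IsSelfAdjoint H) (hmH : m • 1 ≤ H)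
    (hHM : H ≤ M • 1) : spectrum ℝ H ⊆ Set.Icc m M := by
  rw [← Algebra.algebraMap_eq_smul_one] at hmH hHM
  exact fun x hx => ⟨(algebraMap_le_iff_le_spectrum hH).1 hmH x hx,
    (le_algebraMap_iff_spectrum_le hH).1 hHM x hx⟩

theorem smul_one_le_exp_smul {m M p : ℝ} (hH : IsSelfAdjoint H) (hmH : m • 1 ≤ H)
    (hHM : H ≤ M • 1) (hp : 0 ≤ p) :
    Real.exp (p * m) • (1 : Matrix (Fin n) (Fin n) ℂ) ≤ NormedSpace.exp (p • H) := by
  rw [exp_smul_eq_cfc hH, ← Algebra.algebraMap_eq_smul_one]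
  refine algebraMap_le_cfc _ _ _ (fun x hx => ?_) (by fun_prop) hH
  have := (spectrum_subset_Icc hH hmH hHM hx).1
  gcongr

theorem exp_smul_le_smul_one {m M p : ℝ} (hH : IsSelfAdjoint H) (hmH : m • 1 ≤ H)
    (hHM : H ≤ M • 1) (hp : 0 ≤ p) :
    NormedSpace.exp (p • H) ≤ Real.exp (p * M) • (1 : Matrix (Fin n) (Fin n) ℂ) := by
  rw [exp_smul_eq_cfc hH, ← Algebra.algebraMap_eq_smul_one]
  refine cfc_le_algebraMap _ _ _ (fun x hx => ?_) (by fun_prop) hH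
  have := (spectrum_subset_Icc hH hmH hHM hx).2
  gcongr

/-- The scalar matrix e^{pm} separates the two sides. -/
theorem smul_exp_smul_le_exp_smul {m M p : ℝ} (hH : IsSelfAdjoint H) (hK : IsSelfAdjoint K)
    (hmH : m • 1 ≤ H) (hHM : H ≤ M • 1) (hmK : m • 1 ≤ K) (hKM : K ≤ M • 1) (hp : 0 ≤ p) :
    Real.exp (-(p * (M - m))) • NormedSpace.exp (p • H) ≤ NormedSpace.exp (p • K) := by
  refine le_trans ?_ (smul_one_le_exp_smul hK hmK hKM hp)
  calc Real.exp (-(p * (M - m))) • NormedSpace.exp (p • H)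
      ≤ Real.exp (-(p * (M - m))) • (Real.exp (p * M) • (1 : Matrix (Fin n) (Fin n) ℂ)) :=
        smul_le_smul_of_nonneg_left (exp_smul_le_smul_one hH hmH hHM hp) (Real.exp_pos _).le
    _ = Real.exp (p * m) • 1 := by rw [smul_smul, ← Real.exp_add]; ring_nf

theorem exp_smul_le_smul_exp_smul {m M p : ℝ} (hH : IsSelfAdjoint H) (hK : IsSelfAdjoint K)
    (hmH : m • 1 ≤ H) (hHM : H ≤ M • 1) (hmK : m • 1 ≤ K) (hKM : K ≤ M • 1) (hp : 0 ≤ p) :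
    NormedSpace.exp (p • K) ≤ Real.exp (p * (M - m)) • NormedSpace.exp (p • H) := by
  refine (exp_smul_le_smul_one hK hmK hKM hp).trans ?_
  calc Real.exp (p * M) • (1 : Matrix (Fin n) (Fin n) ℂ)
      = Real.exp (p * (M - m)) • (Real.exp (p * m) • (1 : Matrix (Fin n) (Fin n) ℂ)) := by
        rw [smul_smul, ← Real.exp_add]; ring_nf
    _ ≤ Real.exp (p * (M - m)) • NormedSpace.exp (p • H) :=
        smul_le_smul_of_nonneg_left (smul_one_le_exp_smul hH hmH hHM hp) (Real.exp_pos _).le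

theorem isStrictlyPositive_exp (hH : IsSelfAdjoint H) :
    IsStrictlyPositive (NormedSpace.exp H) := by
  refine (IsStrictlyPositive.iff_of_unital).2 ⟨hH.exp_nonneg, ?_⟩
  exact Matrix.isUnit_exp H

/-- Golden–Thompson type lower bound for the logarithm of a geometric mean, with the Kantorovich
constant as defect. -/
theorem log_kantorovich_add_le_log_geomMean {m M p : ℝ} (hH : IsSelfAdjoint H)
    (hK : IsSelfAdjoint K) (hmM : m ≤ M) (hmH : m • 1 ≤ H) (hHM : H ≤ M • 1) (hmK : m • 1 ≤ K)
    (hKM : K ≤ M • 1) (hp : 0 ≤ p) (hα : α ∈ Set.Icc (0 : ℝ) 1) :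
    IsStrictlyPositive (geomMean α (NormedSpace.exp (p • H)) (NormedSpace.exp (p • K))) ∧
    Real.log (kantorovich (Real.exp (2 * p * (M - m))) α) • (1 : Matrix (Fin n) (Fin n) ℂ) +
        p • ((1 - α) • H + α • K) ≤
      CFC.log (geomMean α (NormedSpace.exp (p • H)) (NormedSpace.exp (p • K))) := by
  have hpH := (IsSelfAdjoint.all p).smul hH
  have hpK := (IsSelfAdjoint.all p).smul hK
  have hA := isStrictlyPositive_exp hpH
  have hB := isStrictlyPositive_exp hpK
  obtain ⟨a, b, ha, hb, hκ, hlin⟩ := exists_linear_le_rpow_kantorovich hα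
    (mul_nonneg hp (sub_nonneg.2 hmM))
  have ha := (Real.exp_pos _).trans_le ha
  have hb := (Real.exp_pos _).trans_le hb
  have hle := linear_le_geomMean hA hB.nonneg (Real.exp_pos _)
    (smul_exp_smul_le_exp_smul hH hK hmH hHM hmK hKM hp)
    (exp_smul_le_smul_exp_smul hH hK hmH hHM hmK hKM hp) hlin
  have hpos : IsStrictlyPositive (((1 - α) * a) • NormedSpace.exp (p • H) +
      (α * b) • NormedSpace.exp (p • K)) := by
    have := CFC.concaveOn_log.1 (hA.smul ha) (hB.smul hb) (sub_nonneg.2 hα.2) hα.1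
      (sub_add_cancel 1 α)
    rwa [smul_smul, smul_smul] at this
  -- The mean is strictly positive because it dominates a strictly positive combination.
  refine ⟨hpos.of_le hle, le_trans (le_of_eq ?_)
    ((log_add_smul_le_log_add hA hB hα ha hb).trans (CFC.log_le_log hle hpos))⟩
  rw [CFC.log_exp _ hpH, CFC.log_exp _ hpK, mul_assoc 2 p, hκ]
  module

theorem exp_smul_le_linear {m M p R : ℝ} (hH : IsSelfAdjoint H)
    (hmH : m • 1 ≤ H) (hHM : H ≤ M • 1) (hm : -R ≤ m) (hM : M ≤ R) (hp : 0 ≤ p)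
    (hpR : p * R ≤ 1) :
    NormedSpace.exp (p • H) ≤ (1 + (p * R) ^ 2) • (1 : Matrix (Fin n) (Fin n) ℂ) + p • H := by
  rw [exp_smul_eq_cfc hH, ← cfc_const_add_mul_eq hH]
  refine cfc_mono (fun x hx => ?_) (by fun_prop) (by fun_prop)
  have hx := spectrum_subset_Icc hH hmH hHM hx
  have hxR : |p * x| ≤ p * R := by
    rw [abs_mul, abs_of_nonneg hp]
    exact mul_le_mul_of_nonneg_left (abs_le.2 ⟨by linarith [hx.1], by linarith [hx.2]⟩) hp
  have h1 := (abs_le.1 (Real.abs_exp_sub_one_sub_id_le (hxR.trans hpR))).2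
  have h2 : (p * x) ^ 2 ≤ (p * R) ^ 2 := sq_le_sq' (by linarith [(abs_le.1 hxR).1])
    (abs_le.1 hxR).2
  linarith

theorem geomMean_exp_le_linear {m M p R : ℝ} (hH : IsSelfAdjoint H)
    (hK : IsSelfAdjoint K) (hmH : m • 1 ≤ H) (hHM : H ≤ M • 1) (hmK : m • 1 ≤ K)
    (hKM : K ≤ M • 1) (hm : -R ≤ m) (hM : M ≤ R) (hp : 0 ≤ p) (hpR : p * R ≤ 1)
    (hα : α ∈ Set.Icc (0 : ℝ) 1) :
    geomMean α (NormedSpace.exp (p • H)) (NormedSpace.exp (p • K)) ≤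
      (1 + (p * R) ^ 2) • (1 : Matrix (Fin n) (Fin n) ℂ) + p • ((1 - α) • H + α • K) := by
  have hA := isStrictlyPositive_exp ((IsSelfAdjoint.all p).smul hH)
  have hB := isStrictlyPositive_exp ((IsSelfAdjoint.all p).smul hK)
  refine (geomMean_le_linear hA hB.nonneg (Real.exp_pos _)
    (smul_exp_smul_le_exp_smul hH hK hmH hHM hmK hKM hp)
    (exp_smul_le_smul_exp_smul hH hK hmH hHM hmK hKM hp)
    fun x hx => rpow_le_one_sub_add_mul hα ((Real.exp_pos _).le.trans hx.1)).trans ?_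
  refine (add_le_add
    (smul_le_smul_of_nonneg_left (exp_smul_le_linear hH hmH hHM hm hM hp hpR) (sub_nonneg.2 hα.2))
    (smul_le_smul_of_nonneg_left (exp_smul_le_linear hK hmK hKM hm hM hp hpR) hα.1)).trans
    (le_of_eq ?_)
  module

end

/-! ### Ordered eigenvalues of exponentials, logarithms and affine images -/

theorem lam_congr {n : ℕ} {A B : Matrix (Fin n) (Fin n) ℂ} (h : A = B) (hA : A.IsHermitian)
    (hB : B.IsHermitian) (k : Fin n) : lam A hA k = lam B hB k := by
  subst h; rfl

section

open scoped Matrix.Norms.L2Operator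

variable {n : ℕ} {H K : Matrix (Fin n) (Fin n) ℂ} {α : ℝ}

theorem lam_exp (hH : H.IsHermitian) (hE : (NormedSpace.exp H).IsHermitian) (k : Fin n) :
    lam (NormedSpace.exp H) hE k = Real.exp (lam H hH k) := by
  have h : cfc Real.exp H = NormedSpace.exp H := CFC.real_exp_eq_normedSpace_exp hH
  rw [lam_congr h.symm hE (h ▸ hE),
    lam_cfc hH (Real.exp_monotone.monotoneOn _)]

theorem lam_smul_one_add_smul (hH : H.IsHermitian) (s : ℝ) {t : ℝ} (ht : 0 ≤ t)
    (hE : (s • 1 + t • H).IsHermitian) (k : Fin n) :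
    lam (s • 1 + t • H) hE k = s + t * lam H hH k := by
  have h := cfc_const_add_mul_eq hH s t
  rw [lam_congr h.symm hE (h ▸ hE), lam_cfc hH]
  exact Monotone.monotoneOn (fun x y hxy => by gcongr) _

theorem lam_pos (hH : H.IsHermitian) (hpos : IsStrictlyPositive H) (k : Fin n) :
    0 < lam H hH k :=
  hpos.spectrum_pos (lam_mem_spectrum hH k)

theorem lam_log (hH : H.IsHermitian) (hpos : IsStrictlyPositive H)
    (hE : (CFC.log H).IsHermitian) (k : Fin n) :
    lam (CFC.log H) hE k = Real.log (lam H hH k) :=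
  lam_cfc hH (Real.strictMonoOn_log.monotoneOn.mono fun _ hx => hpos.spectrum_pos hx) hE k

end

/-! ### Two-sided eigenvalue bounds -/

section

variable {n : ℕ} {H K : Matrix (Fin n) (Fin n) ℂ} {α m M p : ℝ}

theorem Matrix.IsHermitian.real_smul_add_smul (hH : H.IsHermitian) (hK : K.IsHermitian)
    (a b : ℝ) : (a • H + b • K).IsHermitian :=
  (hH.smul (IsSelfAdjoint.all a)).add (hK.smul (IsSelfAdjoint.all b))

/-- κ is a weighted geometric mean of a and b, each above this bound. -/
theorem exp_neg_half_sq_le_kantorovich (hα : α ∈ Set.Icc (0 : ℝ) 1) (hmM : m ≤ M) (hp : 0 ≤ p) :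
    Real.exp (-((p * (M - m)) ^ 2 / 2)) ≤ kantorovich (Real.exp (2 * p * (M - m))) α := by
  obtain ⟨a, b, ha, hb, hκ, -⟩ := exists_linear_le_rpow_kantorovich hα
    (mul_nonneg hp (sub_nonneg.2 hmM))
  set c := Real.exp (-((p * (M - m)) ^ 2 / 2)) with hc
  have hc0 : 0 < c := Real.exp_pos _
  have hα' := sub_nonneg.2 hα.2
  have hα0 := hα.1
  have ha0 := hc0.le.trans ha
  calc c = c ^ (1 - α) * c ^ α := by rw [← Real.rpow_add hc0, sub_add_cancel, Real.rpow_one]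
    _ ≤ a ^ (1 - α) * b ^ α := by gcongr
    _ = _ := by rw [mul_assoc, hκ]

open scoped Matrix.Norms.L2Operator in
theorem lam_exp_le_kantorovich_mul_lam_geomMean (hH : H.IsHermitian) (hK : K.IsHermitian)
    (hmM : m ≤ M) (hmH : m • 1 ≤ H) (hHM : H ≤ M • 1) (hmK : m • 1 ≤ K) (hKM : K ≤ M • 1)
    (hp : 0 < p) (hα : α ∈ Set.Icc (0 : ℝ) 1) (k : Fin n) :
    lam (NormedSpace.exp ((1 - α) • H + α • K)) (isHermitian_exp_comb hH hK (1 - α) α) k ≤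
      kantorovich (Real.exp (2 * p * (M - m))) α ^ (-(1 / p)) *
        lam (geomMean α (NormedSpace.exp (p • H)) (NormedSpace.exp (p • K)))
          (isHermitian_geomMean _ _ _) k ^ (1 / p) := by
  obtain ⟨hG, hle⟩ := log_kantorovich_add_le_log_geomMean hH hK hmM hmH hHM hmK hKM hp.le hα
  have hL := hH.real_smul_add_smul hK (1 - α) α
  have hlam := lam_mono (Matrix.isHermitian_one.real_smul_add_smul hL _ p)
    (IsSelfAdjoint.log (A := Matrix (Fin n) (Fin n) ℂ)).isHermitian hle k
  rw [lam_smul_one_add_smul hL _ hp.le, lam_log (isHermitian_geomMean _ _ _) hG] at hlam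
  have hκ := (Real.exp_pos _).trans_le (exp_neg_half_sq_le_kantorovich hα hmM hp.le)
  rw [lam_exp hL, Real.rpow_def_of_pos hκ, Real.rpow_def_of_pos (lam_pos _ hG k), ← Real.exp_add,
    Real.exp_le_exp, ← mul_le_mul_iff_of_pos_left hp]
  refine (le_sub_iff_add_le'.2 hlam).trans (le_of_eq ?_)
  field_simp
  ring

open scoped Matrix.Norms.L2Operator in
theorem kantorovich_mul_lam_geomMean_le {R : ℝ} (hH : H.IsHermitian) (hK : K.IsHermitian)
    (hmM : m ≤ M) (hmH : m • 1 ≤ H) (hHM : H ≤ M • 1) (hmK : m • 1 ≤ K) (hKM : K ≤ M • 1)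
    (hm : -R ≤ m) (hM : M ≤ R) (hp : 0 < p) (hpR : p * R ≤ 1)
    (hα : α ∈ Set.Icc (0 : ℝ) 1) (k : Fin n) :
    kantorovich (Real.exp (2 * p * (M - m))) α ^ (-(1 / p)) *
        lam (geomMean α (NormedSpace.exp (p • H)) (NormedSpace.exp (p • K)))
          (isHermitian_geomMean _ _ _) k ^ (1 / p) ≤
      Real.exp (p * ((M - m) ^ 2 / 2 + R ^ 2)) *
        lam (NormedSpace.exp ((1 - α) • H + α • K)) (isHermitian_exp_comb hH hK (1 - α) α) k := by
  have hG := (log_kantorovich_add_le_log_geomMean hH hK hmM hmH hHM hmK hKM hp.le hα).1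
  have hL := hH.real_smul_add_smul hK (1 - α) α
  have hlam := lam_mono (isHermitian_geomMean _ _ _)
    (Matrix.isHermitian_one.real_smul_add_smul hL _ p)
    (geomMean_exp_le_linear hH hK hmH hHM hmK hKM hm hM hp.le hpR hα) k
  rw [lam_smul_one_add_smul hL _ hp.le] at hlam
  -- Replacing 1 + y by e^y makes the power 1/p computable: it turns (pR)² into pR².
  have hlam' := hlam.trans (b := _) (c := Real.exp ((p * R) ^ 2 + p * lam _ hL k))
    (by linarith [Real.add_one_le_exp ((p * R) ^ 2 + p * lam _ hL k)])
  have hκ := exp_neg_half_sq_le_kantorovich hα hmM hp.le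
  have hp' : 0 ≤ 1 / p := by positivity
  have h1 : kantorovich (Real.exp (2 * p * (M - m))) α ^ (-(1 / p)) ≤
      Real.exp (p * ((M - m) ^ 2 / 2)) := by
    refine (Real.rpow_le_rpow_of_nonpos (Real.exp_pos _) hκ (neg_nonpos.2 hp')).trans
      (le_of_eq ?_)
    rw [← Real.exp_mul]
    congr 1
    field_simp
  have h2 := Real.rpow_le_rpow (lam_pos _ hG k).le hlam' hp'
  rw [lam_exp hL]
  refine (mul_le_mul h1 h2 (Real.rpow_nonneg (lam_pos _ hG k).le _) (Real.exp_pos _).le).trans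
    (le_of_eq ?_)
  rw [← Real.exp_mul, ← Real.exp_add, ← Real.exp_add]
  congr 1
  field_simp
  ring

theorem inv_kantorovich_exp_half (hmM : m ≤ M) :
    (kantorovich (Real.exp (2 * 1 * (2 * M - 2 * m))) (1 / 2))⁻¹ =
      (Real.exp (2 * M) + Real.exp (2 * m)) / (2 * Real.exp M * Real.exp m) := by
  have hcosh : (Real.exp (2 * M) + Real.exp (2 * m)) / (2 * Real.exp M * Real.exp m) =
      Real.cosh (M - m) := by
    rw [Real.cosh_eq, Real.exp_neg, Real.exp_sub, two_mul, two_mul, Real.exp_add, Real.exp_add]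
    field_simp
  rw [hcosh]
  rcases hmM.eq_or_lt with rfl | hlt
  · simp [kantorovich]
  · have hs : 0 < Real.sinh (M - m) := Real.sinh_pos_iff.2 (by linarith)
    have hc := Real.cosh_pos (M - m)
    rw [show 2 * 1 * (2 * M - 2 * m) = 2 * (2 * (M - m)) by ring,
      kantorovich_exp_two_mul (by norm_num) (by norm_num) (by linarith),
      show (1 - 1 / 2 : ℝ) = 1 / 2 by norm_num,
      show 1 / 2 * (2 * (M - m)) = M - m by ring, Real.sinh_two_mul,
      ← Real.rpow_add (by positivity)]
    norm_num
    field_simp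

end

/-! ### Main theorem -/

theorem theorem3p2 {n : ℕ} (H K : Matrix (Fin n) (Fin n) ℂ)
    (hH : H.IsHermitian) (hK : K.IsHermitian) (m M : ℝ) (hmM : m ≤ M)
    (hmH : m • (1 : Matrix (Fin n) (Fin n) ℂ) ≤ H) (hHM : H ≤ M • (1 : Matrix (Fin n) (Fin n) ℂ))
    (hmK : m • (1 : Matrix (Fin n) (Fin n) ℂ) ≤ K) (hKM : K ≤ M • (1 : Matrix (Fin n) (Fin n) ℂ)) :
    (∀ α ∈ Set.Icc (0 : ℝ) 1, ∀ k : Fin n,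
      (∀ p : ℝ, 0 < p →
        lam (NormedSpace.exp ((1 - α) • H + α • K)) (isHermitian_exp_comb hH hK (1 - α) α) k ≤
          kantorovich (Real.exp (2 * p * (M - m))) α ^ (-(1 / p)) *
            lam (geomMean α (NormedSpace.exp (p • H)) (NormedSpace.exp (p • K)))
              (isHermitian_geomMean _ _ _) k ^ (1 / p)) ∧
      Filter.Tendsto
        (fun p : ℝ => kantorovich (Real.exp (2 * p * (M - m))) α ^ (-(1 / p)) *
          lam (geomMean α (NormedSpace.exp (p • H)) (NormedSpace.exp (p • K)))
            (isHermitian_geomMean _ _ _) k ^ (1 / p))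
        (nhdsWithin 0 (Set.Ioi 0))
        (nhds (lam (NormedSpace.exp ((1 - α) • H + α • K))
          (isHermitian_exp_comb hH hK (1 - α) α) k))) ∧
    ∀ k : Fin n,
      lam (NormedSpace.exp (H + K)) (isHermitian_exp_add hH hK) k ≤
        (Real.exp (2 * M) + Real.exp (2 * m)) / (2 * Real.exp M * Real.exp m) *
          lam (geomMean (1 / 2) (NormedSpace.exp ((2 : ℝ) • H)) (NormedSpace.exp ((2 : ℝ) • K)))
            (isHermitian_geomMean _ _ _) k := by
  refine ⟨fun α hα k => ⟨fun p hp =>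
    lam_exp_le_kantorovich_mul_lam_geomMean hH hK hmM hmH hHM hmK hKM hp hα k, ?_⟩, fun k => ?_⟩
  · set R : ℝ := max |m| |M| with hR
    have hm : -R ≤ m := (neg_le_neg (le_max_left _ _)).trans (neg_abs_le m)
    have hM : M ≤ R := (le_abs_self M).trans (le_max_right _ _)
    set l := lam (NormedSpace.exp ((1 - α) • H + α • K)) (isHermitian_exp_comb hH hK (1 - α) α) k
    have hlim : Filter.Tendsto (fun p : ℝ => Real.exp (p * ((M - m) ^ 2 / 2 + R ^ 2)) * l)
        (nhdsWithin 0 (Set.Ioi 0)) (nhds l) := by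
      have hcont : Continuous fun p : ℝ => Real.exp (p * ((M - m) ^ 2 / 2 + R ^ 2)) * l := by
        fun_prop
      simpa using (hcont.tendsto 0).mono_left nhdsWithin_le_nhds
    have hsmall : ∀ᶠ p : ℝ in nhdsWithin 0 (Set.Ioi 0), p * R ≤ 1 := by
      have hcont : Continuous fun p : ℝ => p * R := by fun_prop
      exact nhdsWithin_le_nhds ((hcont.tendsto 0).eventually_le_const (by simp))
    refine tendsto_of_tendsto_of_tendsto_of_le_of_le' tendsto_const_nhds hlim ?_ ?_
    · filter_upwards [self_mem_nhdsWithin] with p hp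
      exact lam_exp_le_kantorovich_mul_lam_geomMean hH hK hmM hmH hHM hmK hKM hp hα k
    · filter_upwards [self_mem_nhdsWithin, hsmall] with p hp hpR
      exact kantorovich_mul_lam_geomMean_le hH hK hmM hmH hHM hmK hKM hm hM hp hpR hα k
  · have hscale : ∀ {X Y : Matrix (Fin n) (Fin n) ℂ}, X ≤ Y → (2 : ℝ) • X ≤ (2 : ℝ) • Y :=
      fun h => smul_le_smul_of_nonneg_left h zero_le_two
    -- Apply the bound to 2H and 2K with p = 1 and α = 1/2, whose weighted sum is H + K; the factor
    -- κ^{-1} is then cosh(M-m).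
    have h := lam_exp_le_kantorovich_mul_lam_geomMean (m := 2 * m) (M := 2 * M)
      (hH.smul (IsSelfAdjoint.all (2 : ℝ))) (hK.smul (IsSelfAdjoint.all (2 : ℝ)))
      (by linarith) (by rw [mul_smul]; exact hscale hmH) (by rw [mul_smul]; exact hscale hHM)
      (by rw [mul_smul]; exact hscale hmK) (by rw [mul_smul]; exact hscale hKM) one_pos
      (α := 1 / 2) (by norm_num) k
    rw [div_one, Real.rpow_neg_one, Real.rpow_one, inv_kantorovich_exp_half hmM] at h
    refine (le_of_eq (lam_congr ?_ _ _ k)).trans (h.trans (le_of_eq ?_))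
    · congr 1
      module
    · congr 1
      exact lam_congr (by rw [one_smul, one_smul]) _ _ k
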